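/- Let $W\in C^2(\mathbb{R}^m\times\mathbb{R}^m;[0,\infty))$ satisfy: - $(\mathbf H_1)$ The set $A=\{u\in\mathbb{R}^m: W(u,0)=0\}$ is the union of two nonempty disjoint compact sets $A^-$ and $A^+$. - $(\mathbf H_2)$ $\Omega\subset\mathbb{R}^m$ is an open set with $A^-\subset\Omega$, $A^+\cap\overline\Omega=\emptyset$, and $W(u,v)>0$ for all $u\in\partial\Omega$, $v\in\mathbb{R}^m$. - $(\mathbf H_3)$ $\liminf_{|u|\to\infty}W(u,v)>0$ uniformly in $v\in\mathbb{R}^m$. Let $d$ denote the Euclidean distance, and let $q\in\big(0,\tfrac12 d(A^-,A^+)\big)$ be such that $\{u: d(u,A^-)\le q\}\subset\Omega$ and $\{u: d(u,A^+)\le q\}\cap\overline\Omega=\emptyset$. Let $\mathcal A$ be the class of all $u\in W^{2,2}_{\rm loc}(\mathbb{R};\mathbb{R}^m)$ (identified with their continuous representatives) for which there are $x_u^-<x_u^+$ with $d(u(x),A^-)\le q$ for all $x\le x_u^-$ and $d(u(x),A^+)\le q$ for all $x\ge x_u^+$. Let $\bar u\in\mathcal A$ be a minimizer in $\mathcal A$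 of $$J_{\mathbb{R}}(u)=\int_{\mathbb{R}}\Big(\tfrac12|u''|^2+W(u,u')\Big)\,dx .$$ Assume moreover that $A^-$ is a compact orientable embedded $C^2$ hypersurface of $\mathbb{R}^m$ (without boundary), with continuous unit normal field $\mathbf n$, and that $W$ is nondegenerate in the directions normal to $A^-\times\{0\}$: $$\frac{d^2}{ds^2}W\big(a+s\alpha\,\mathbf n(a),\,s\nu\big)\Big|_{s=0}>0\qquad\text{for all } a\in A^-,\ \alpha\in\mathbb{R},\ \nu\in\mathbb{R}^m\ \text{with } \alpha^2+|\nu|^2=1 .$$ Then there exists $l\in A^-$ such that $\bar u(x)\to l$ as $x\to-\infty$. -/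

import Mathlib

open Set Filter Topology MeasureTheory
open scoped ENNReal ContDiff

noncomputable section

namespace Heteroclinic

/-- `ℝ^m` with the Euclidean norm. -/
abbrev E (m : ℕ) := EuclideanSpace ℝ (Fin m)

/-- `u ∈ L²_loc(ℝ; ℝ^m)`. -/
def IsL2loc {m : ℕ} (u : ℝ → E m) : Prop :=
  ∀ a b : ℝ, MemLp u 2 (volume.restrict (Icc a b))

/-- `v` is the weak (distributional) derivative of `u` on `ℝ`, tested against `C_c^∞(ℝ)`. -/
def IsWeakDeriv {m : ℕ} (u v : ℝ → E m) : Prop :=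
  ∀ φ : ℝ → ℝ, ContDiff ℝ ∞ φ → HasCompactSupport φ →
    ∫ x, deriv φ x • u x = - ∫ x, φ x • v x

/-- An element of `W^{2,2}_loc(ℝ; ℝ^m)`: a map `u` (its continuous representative, as usual in
dimension one), together with representatives `d1`, `d2` of its first and second weak
derivatives; all three are in `L²_loc`. -/
structure W22loc (m : ℕ) where
  toFun : ℝ → E m
  d1 : ℝ → E m
  d2 : ℝ → E m
  continuous_toFun : Continuous toFun
  l2_toFun : IsL2loc toFun
  l2_d1 : IsL2loc d1
  l2_d2 : IsL2loc d2
  weak_d1 : IsWeakDeriv toFun d1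
  weak_d2 : IsWeakDeriv d1 d2

/-- The energy `J_ℝ(u) = ∫_ℝ (½ |u''|² + W(u, u')) ∈ [0, ∞]`. -/
def energy {m : ℕ} (W : E m × E m → ℝ) (u : W22loc m) : ℝ≥0∞ :=
  ∫⁻ x, ENNReal.ofReal (‖u.d2 x‖ ^ 2 / 2 + W (u.toFun x, u.d1 x))

/-- The distance `d(S, T) = inf {|a - b| : a ∈ S, b ∈ T}` of two sets. -/
def setDist {m : ℕ} (S T : Set (E m)) : ℝ := sInf (Set.image2 dist S T)

/-- The zero set `{u : W(u, 0) = 0}` is partitioned into two nonempty disjoint compact sets. -/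
structure HypH1 {m : ℕ} (W : E m × E m → ℝ) (Am Ap : Set (E m)) : Prop where
  zeros : {u : E m | W (u, 0) = 0} = Am ∪ Ap
  disj : Disjoint Am Ap
  nonempty_m : Am.Nonempty
  nonempty_p : Ap.Nonempty
  compact_m : IsCompact Am
  compact_p : IsCompact Ap

/-- `Ω` is an open set containing `Am`, whose closure misses `Ap`, with `W > 0` over `∂Ω`. -/
structure HypH2 {m : ℕ} (W : E m × E m → ℝ) (Am Ap Ω : Set (E m)) : Prop where
  isOpen : IsOpen Ω
  subset : Am ⊆ Ω
  inter_closure : Ap ∩ closure Ω = ∅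
  pos : ∀ u ∈ frontier Ω, ∀ v : E m, 0 < W (u, v)

/-- `liminf_{|u| → ∞} W(u, v) > 0`, uniformly in `v`. -/
def HypH3 {m : ℕ} (W : E m × E m → ℝ) : Prop :=
  ∃ c > (0 : ℝ), ∃ R : ℝ, ∀ u : E m, R ≤ ‖u‖ → ∀ v : E m, c ≤ W (u, v)

/-- The admissible radii `q` in the definition of the class of competitors. -/
structure AdmissibleRadius {m : ℕ} (Am Ap Ω : Set (E m)) (q : ℝ) : Prop where
  pos : 0 < q
  lt : q < setDist Am Ap / 2
  subset : {u : E m | Metric.infDist u Am ≤ q} ⊆ Ω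
  inter_closure : {u : E m | Metric.infDist u Ap ≤ q} ∩ closure Ω = ∅

/-- The class of `W^{2,2}_loc` maps that are `q`-close to `Am` near `-∞` and `q`-close to `Ap`
near `+∞`. -/
def competitors {m : ℕ} (Am Ap : Set (E m)) (q : ℝ) : Set (W22loc m) :=
  {u | ∃ xm xp : ℝ, xm < xp ∧
    (∀ x ≤ xm, Metric.infDist (u.toFun x) Am ≤ q) ∧
    (∀ x ≥ xp, Metric.infDist (u.toFun x) Ap ≤ q)}

/-- `S ⊆ ℝ^m` is an embedded hypersurface of class `C²` (without boundary), oriented by the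
continuous unit normal field `n`: near each of its points `S` is the zero set of a `C²` function
whose gradient at the points of `S` is a nonzero multiple of `n`. -/
structure IsOrientedC2Hypersurface {m : ℕ} (S : Set (E m)) (n : E m → E m) : Prop where
  continuousOn_normal : ContinuousOn n S
  norm_normal : ∀ a ∈ S, ‖n a‖ = 1
  local_eq : ∀ a ∈ S, ∃ (U : Set (E m)) (f : E m → ℝ),
    IsOpen U ∧ a ∈ U ∧ ContDiffOn ℝ 2 f U ∧ S ∩ U = {x ∈ U | f x = 0} ∧
    ∀ x ∈ S ∩ U, ∃ c : ℝ, c ≠ 0 ∧ HasGradientAt f (c • n x) x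

/-- Nondegeneracy of `W` along `S × {0}`: the second derivative of `W` at `(a, 0)`, `a ∈ S`, is
positive in every direction `(α n(a), ν)` normal to `S × {0}` (directions of unit length). -/
def NormallyNondegenerate {m : ℕ} (W : E m × E m → ℝ) (S : Set (E m)) (n : E m → E m) : Prop :=
  ∀ a ∈ S, ∀ (α : ℝ) (ν : E m), α ^ 2 + ‖ν‖ ^ 2 = 1 →
    0 < iteratedDeriv 2 (fun s : ℝ => W (a + s • (α • n a), s • ν)) 0

end Heteroclinic

end

namespace Heteroclinic

/-! Write `u` for the minimizer, `v` for its continuous derivative and F(x) for the integral of W(u,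
v) over (-∞, x]. The core is a differential inequality F ≤ K F' near -∞, obtained by comparison.
Take p in A⁻ nearest to u(x), and replace `u` left of x by a cubic transition on [x - 1, x) preceded
by the constant p (`exists_splice`). Minimality bounds the energy on (-∞, x) by the cost of the
transition. That cost is at most a constant times |u(x) - p|² + |v(x)|², since W ≥ 0 vanishes to
second order on A⁻ × {0} (`exists_le_mul_norm_sq`). Because u(x) - p is normal to A⁻, nondegeneracy
bounds this sum by a multiple of W(u(x), v(x)) = F'(x) (`exists_quadratic_lower_bound`).

The same lower bound gives c|v|² ≤ F'. Multiplying the two inequalities bounds |v| by a multiple of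
(√F)', so `u` has finite length near -∞ and converges (`exists_tendsto_atBot_of_le_deriv`). No decay
rate is needed.

These local bounds apply once v → 0 and d(u, A⁻) → 0 at -∞, which follows from finite energy
(`tendsto_deriv_atBot_zero`, `tendsto_infDist_atBot_zero`). The second limit also places the limit
point of `u` in A⁻. -/

/-! ### Primitives and weak derivatives on the line. -/

theorem _root_.MeasureTheory.LocallyIntegrable.intervalIntegrable_real {V : Type*}
    [NormedAddCommGroup V] {g : ℝ → V} (hg : LocallyIntegrable g)
    (a b : ℝ) : IntervalIntegrable g volume a b :=
  intervalIntegrable_iff.mpr <|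
    (hg.integrableOn_isCompact isCompact_uIcc).mono_set uIoc_subset_uIcc

/-- `f` is a primitive of the locally integrable function `g`. -/
structure IsPrimitive {V : Type*} [NormedAddCommGroup V] [NormedSpace ℝ V] (f g : ℝ → V) :
    Prop where
  locallyIntegrable : LocallyIntegrable g
  sub_eq : ∀ a b, f b - f a = ∫ x in a..b, g x

section Primitive

variable {V : Type*} [NormedAddCommGroup V] [NormedSpace ℝ V] {f g : ℝ → V}

theorem IsPrimitive.of_base (hg : LocallyIntegrable g) (c : ℝ)
    (h : ∀ y, f y = f c + ∫ x in c..y, g x) : IsPrimitive f g := by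
  refine ⟨hg, fun a b => ?_⟩
  rw [h a, h b, add_sub_add_left_eq_sub, intervalIntegral.integral_interval_sub_left]
  · exact hg.intervalIntegrable_real _ _
  · exact hg.intervalIntegrable_real _ _

theorem IsPrimitive.eq_add (h : IsPrimitive f g) (a b : ℝ) :
    f b = f a + ∫ x in a..b, g x := by
  rw [← h.sub_eq a b]; abel

theorem isPrimitive_integral (hg : LocallyIntegrable g) (c : ℝ) :
    IsPrimitive (fun y => ∫ x in c..y, g x) g :=
  .of_base hg c fun y => by simp

theorem IsPrimitive.const_add (h : IsPrimitive f g) (c : V) :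
    IsPrimitive (fun y => c + f y) g :=
  ⟨h.locallyIntegrable, fun a b => by rw [← h.sub_eq a b]; abel⟩

theorem IsPrimitive.congr_ae {g' : ℝ → V} (h : IsPrimitive f g) (hg : g =ᵐ[volume] g') :
    IsPrimitive f g' :=
  ⟨h.locallyIntegrable.congr hg, fun a b => by
    rw [h.sub_eq a b]
    exact intervalIntegral.integral_congr_ae (hg.mono fun x hx _ => hx)⟩

theorem IsPrimitive.continuous (h : IsPrimitive f g) : Continuous f := by
  have : f = fun y => f 0 + ∫ x in (0 : ℝ)..y, g x := funext fun y => h.eq_add 0 y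
  rw [this]
  exact continuous_const.add
    (intervalIntegral.continuous_primitive (h.locallyIntegrable.intervalIntegrable_real) 0)

theorem IsPrimitive.hasDerivAt [CompleteSpace V] (h : IsPrimitive f g) (hg : Continuous g)
    (x : ℝ) : HasDerivAt f (g x) x := by
  have : f = fun y => f 0 + ∫ x in (0 : ℝ)..y, g x := funext fun y => h.eq_add 0 y
  rw [this]
  exact (intervalIntegral.integral_hasDerivAt_right (hg.intervalIntegrable _ _)
    (hg.stronglyMeasurableAtFilter _ _) hg.continuousAt).const_add _

theorem isPrimitive_of_hasDerivAt [CompleteSpace V] (hg : Continuous g)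
    (h : ∀ x, HasDerivAt f (g x) x) : IsPrimitive f g :=
  ⟨hg.locallyIntegrable, fun a b => (intervalIntegral.integral_eq_sub_of_hasDerivAt
    (fun x _ => h x) (hg.intervalIntegrable a b)).symm⟩

/-- Two primitives which agree at `c` can be glued there. -/
theorem IsPrimitive.glue {f₁ g₁ f₂ g₂ : ℝ → V} (h₁ : IsPrimitive f₁ g₁) (h₂ : IsPrimitive f₂ g₂)
    {c : ℝ} (hc : f₁ c = f₂ c) :
    IsPrimitive ((Iio c).piecewise f₁ f₂) ((Iio c).piecewise g₁ g₂) := by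
  classical
  have hloc : LocallyIntegrable ((Iio c).piecewise g₁ g₂) := by
    intro x
    obtain ⟨s, hs, hs'⟩ := h₁.locallyIntegrable x
    obtain ⟨t, ht, ht'⟩ := h₂.locallyIntegrable x
    refine ⟨s ∩ t, inter_mem hs ht, ?_⟩
    exact Integrable.piecewise measurableSet_Iio
      ((hs'.mono_set inter_subset_left).integrableOn)
      ((ht'.mono_set inter_subset_right).integrableOn)
  refine .of_base hloc c fun y => ?_
  have hpc : (Iio c).piecewise f₁ f₂ c = f₂ c := by simp
  rw [hpc]
  rcases lt_or_ge y c with hy | hy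
  · rw [piecewise_eq_of_mem _ _ _ (mem_Iio.2 hy), ← hc, h₁.eq_add c y]
    congr 1
    refine intervalIntegral.integral_congr_ae ?_
    have : ∀ᵐ x : ℝ, x ≠ c := by simp [ae_iff, measure_singleton]
    filter_upwards [this] with x hx hxm
    rw [uIoc_of_ge hy.le] at hxm
    rw [piecewise_eq_of_mem _ _ _ (mem_Iio.2 (lt_of_le_of_ne hxm.2 hx))]
  · rw [piecewise_eq_of_notMem _ _ _ (by simpa using hy), h₂.eq_add c y]
    congr 1
    refine intervalIntegral.integral_congr_ae (Eventually.of_forall fun x hxm => ?_)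
    rw [uIoc_of_le hy] at hxm
    rw [piecewise_eq_of_notMem _ _ _ (by simpa using hxm.1.le)]

theorem absolutelyContinuousOnInterval_of_dist_le {X Y : Type*} [PseudoMetricSpace X]
    [PseudoMetricSpace Y] {u : ℝ → X} {v : ℝ → Y} {a b : ℝ}
    (hv : AbsolutelyContinuousOnInterval v a b)
    (h : ∀ x y, dist (u x) (u y) ≤ dist (v x) (v y)) :
    AbsolutelyContinuousOnInterval u a b :=
  squeeze_zero (fun _ => Finset.sum_nonneg fun _ _ => dist_nonneg)
    (fun _ => Finset.sum_le_sum fun _ _ => h _ _) hv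

theorem IsPrimitive.absolutelyContinuousOnInterval (h : IsPrimitive f g) (a b : ℝ) :
    AbsolutelyContinuousOnInterval f a b := by
  have hn : LocallyIntegrable fun x => ‖g x‖ := fun x =>
    let ⟨s, hs, hs'⟩ := h.locallyIntegrable x
    ⟨s, hs, hs'.norm⟩
  have hi := hn.intervalIntegrable_real
  refine absolutelyContinuousOnInterval_of_dist_le
    ((hi a b).absolutelyContinuousOnInterval_intervalIntegral (c := a) left_mem_uIcc) fun x y => ?_
  rw [dist_comm, dist_comm (∫ _ in a..x, _), dist_eq_norm, h.sub_eq x y, Real.dist_eq,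
    intervalIntegral.integral_interval_sub_left (hi _ _) (hi _ _)]
  exact intervalIntegral.norm_integral_le_abs_integral_norm

theorem IsPrimitive.ae_hasDerivAt [CompleteSpace V] (h : IsPrimitive f g) :
    ∀ᵐ x, HasDerivAt f (g x) x := by
  filter_upwards [LocallyIntegrable.ae_hasDerivAt_integral h.locallyIntegrable] with x hx
  have : f = fun y => f 0 + ∫ x in (0 : ℝ)..y, g x := funext fun y => h.eq_add 0 y
  rw [this]
  exact (hx 0).const_add _

/-- The product φ • f minus the primitive of its almost-everywhere derivative is absolutely
continuous with zero derivative almost everywhere, hence constant; φ vanishes at both ends of a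
large interval. -/
theorem IsPrimitive.integral_deriv_smul [CompleteSpace V] (h : IsPrimitive f g) {φ : ℝ → ℝ}
    (hφ : ContDiff ℝ ∞ φ) (hc : HasCompactSupport φ) :
    ∫ x, deriv φ x • f x = - ∫ x, φ x • g x := by
  have hφ' : Continuous (deriv φ) := hφ.continuous_deriv (by simp)
  have hI1 : Integrable fun x => deriv φ x • f x :=
    h.continuous.locallyIntegrable.integrable_smul_left_of_hasCompactSupport hφ' hc.deriv
  have hI2 : Integrable fun x => φ x • g x :=
    h.locallyIntegrable.integrable_smul_left_of_hasCompactSupport hφ.continuous hc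
  rw [eq_neg_iff_add_eq_zero, ← integral_add hI1 hI2]
  set k : ℝ → V := fun x => deriv φ x • f x + φ x • g x with hk
  have hkI : Integrable k := hI1.add hI2
  obtain ⟨R, hR⟩ := hc.isCompact.isBounded.subset_ball_lt 0 0
  obtain ⟨hR0, hR⟩ := hR
  have hz : ∀ x, R ≤ |x| → φ x = 0 := fun x hx => by
    by_contra hne
    have := hR (subset_tsupport _ hne)
    rw [Metric.mem_ball, dist_zero_right, Real.norm_eq_abs] at this
    linarith
  have hz' : ∀ x, R ≤ |x| → deriv φ x = 0 := fun x hx => by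
    by_contra hne
    have := hR (support_deriv_subset hne)
    rw [Metric.mem_ball, dist_zero_right, Real.norm_eq_abs] at this
    linarith
  have hsupp : Function.support k ⊆ Ioc (-R) R := by
    intro x hx
    by_contra hne
    refine hx ?_
    have : R ≤ |x| := by
      by_contra hlt
      rw [not_le, abs_lt] at hlt
      exact hne ⟨hlt.1, hlt.2.le⟩
    simp [hk, hz x this, hz' x this]
  rw [← intervalIntegral.integral_eq_integral_of_support_subset hsupp]
  have hP := isPrimitive_integral hkI.locallyIntegrable (-R)
  have hAC : AbsolutelyContinuousOnInterval
      (φ • f - fun y => ∫ x in (-R)..y, k x) (-R) R :=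
    ((hφ.of_le (by simp)).contDiffOn.absolutelyContinuousOnInterval.smul
      (h.absolutelyContinuousOnInterval _ _)).sub (hP.absolutelyContinuousOnInterval _ _)
  obtain ⟨C, hC⟩ := hAC.const_of_ae_hasDerivAt_zero (by
    filter_upwards [h.ae_hasDerivAt, hP.ae_hasDerivAt] with x hx hx' _
    have h1 : HasDerivAt φ (deriv φ x) x :=
      (hφ.differentiable (by simp)).differentiableAt.hasDerivAt
    convert! (h1.smul hx).sub hx' using 1
    simp [hk, add_comm])
  have e1 := hC (-R) left_mem_uIcc
  have e2 := hC R right_mem_uIcc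
  have hRa : R ≤ |R| := le_abs_self R
  have hRa' : R ≤ |-R| := by rw [abs_neg]; exact hRa
  simp only [Pi.sub_apply, Pi.smul_apply', hz _ hRa, hz _ hRa', zero_smul,
    intervalIntegral.integral_same, sub_zero, zero_sub] at e1 e2
  rw [← e1] at e2
  simpa using e2

/-- **Du Bois-Reymond lemma**: a locally integrable function with vanishing weak derivative is
almost everywhere constant. -/
theorem ae_eq_const_of_integral_deriv_smul_eq_zero [CompleteSpace V] (hf : LocallyIntegrable f)
    (h : ∀ φ : ℝ → ℝ, ContDiff ℝ ∞ φ → HasCompactSupport φ → ∫ x, deriv φ x • f x = 0) :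
    ∃ c : V, f =ᵐ[volume] fun _ => c := by
  let b : ContDiffBump (0 : ℝ) := ⟨1, 2, one_pos, one_lt_two⟩
  set ψ : ℝ → ℝ := b.normed volume with hψ
  have hψd : ContDiff ℝ ∞ ψ := b.contDiff_normed
  have hψc : HasCompactSupport ψ := b.hasCompactSupport_normed
  have hψi : ∫ x, ψ x = 1 := b.integral_normed
  refine ⟨∫ x, ψ x • f x, ?_⟩
  refine ae_eq_of_integral_contDiff_smul_eq hf (locallyIntegrable_const _) fun φ hφ hφc => ?_
  rw [integral_smul_const]
  set I := ∫ x, φ x with hI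
  -- Removing the mean of φ makes the primitive of χ compactly supported, so that primitive is an
  -- allowed test function.
  set χ : ℝ → ℝ := fun x => φ x - I * ψ x with hχ
  have hχd : ContDiff ℝ ∞ χ := hφ.sub (contDiff_const.mul hψd)
  have hχc : HasCompactSupport χ := hφc.sub hψc.mul_left
  have hχi : ∫ x, χ x = 0 := by
    rw [integral_sub (hφ.continuous.integrable_of_hasCompactSupport hφc)
      ((hψd.continuous.integrable_of_hasCompactSupport hψc).const_mul _), integral_const_mul, hψi]
    simp [hI]
  obtain ⟨R, hR0, hR⟩ := hχc.isCompact.isBounded.subset_ball_lt 0 0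
  have hz : ∀ x, R ≤ |x| → χ x = 0 := fun x hx => by
    by_contra hne
    have := hR (subset_tsupport _ hne)
    rw [Metric.mem_ball, dist_zero_right, Real.norm_eq_abs] at this
    linarith
  set Φ : ℝ → ℝ := fun y => ∫ x in (-R)..y, χ x with hΦ
  have hΦd : ∀ x, HasDerivAt Φ (χ x) x :=
    (isPrimitive_integral hχd.continuous.locallyIntegrable (-R)).hasDerivAt hχd.continuous
  have hΦderiv : deriv Φ = χ := funext fun x => (hΦd x).deriv
  have hΦcd : ContDiff ℝ ∞ Φ := by
    rw [contDiff_infty_iff_deriv, hΦderiv]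
    exact ⟨fun x => (hΦd x).differentiableAt, hχd⟩
  have hΦc : HasCompactSupport Φ := by
    refine HasCompactSupport.intro (isCompact_Icc (a := -R) (b := R)) fun x hx => ?_
    rw [mem_Icc, not_and_or, not_le, not_le] at hx
    rcases hx with hx | hx
    · refine (intervalIntegral.integral_congr (g := fun _ => (0 : ℝ)) fun y hy => ?_).trans
        (by simp)
      rw [uIcc_of_ge hx.le] at hy
      refine hz y ?_
      rw [abs_of_nonpos (by linarith [hy.2])]
      linarith [hy.2]
    · refine (intervalIntegral.integral_eq_integral_of_support_subset fun y hy => ?_).trans hχi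
      have : ¬ R ≤ |y| := fun hle => hy (hz y hle)
      rw [not_le, abs_lt] at this
      exact ⟨this.1, by linarith [this.2]⟩
  have h0 := h Φ hΦcd hΦc
  rw [hΦderiv] at h0
  have i1 := hf.integrable_smul_left_of_hasCompactSupport hφ.continuous hφc
  have i2 := hf.integrable_smul_left_of_hasCompactSupport hψd.continuous hψc
  have : ∫ x, χ x • f x = (∫ x, φ x • f x) - I • ∫ x, ψ x • f x := by
    rw [← integral_smul]
    refine Eq.trans ?_ (integral_sub i1 (i2.smul I))
    simp [hχ, sub_smul, mul_smul]
  rw [this, sub_eq_zero] at h0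
  exact h0

/-- Subtracting a primitive of g from f leaves a function with zero weak derivative, to which Du
Bois-Reymond applies. -/
theorem exists_isPrimitive_of_integral_deriv_smul [CompleteSpace V] (hf : LocallyIntegrable f)
    (hg : LocallyIntegrable g)
    (h : ∀ φ : ℝ → ℝ, ContDiff ℝ ∞ φ → HasCompactSupport φ →
      ∫ x, deriv φ x • f x = - ∫ x, φ x • g x) :
    ∃ F, IsPrimitive F g ∧ f =ᵐ[volume] F := by
  have hP := isPrimitive_integral hg 0
  obtain ⟨c, hc⟩ := ae_eq_const_of_integral_deriv_smul_eq_zero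
    (f := fun y => f y - ∫ x in (0 : ℝ)..y, g x) (hf.sub hP.continuous.locallyIntegrable)
    fun φ hφ hφc => by
      have hφ' : Continuous (deriv φ) := hφ.continuous_deriv (by simp)
      simp_rw [smul_sub]
      rw [integral_sub (hf.integrable_smul_left_of_hasCompactSupport hφ' hφc.deriv)
        (hP.continuous.locallyIntegrable.integrable_smul_left_of_hasCompactSupport hφ' hφc.deriv),
        h φ hφ hφc, hP.integral_deriv_smul hφ hφc, sub_self]
  exact ⟨_, hP.const_add c, hc.mono fun x hx => sub_eq_iff_eq_add.1 hx⟩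

end Primitive

/-! ### Maps of class W^{2,2}_loc as iterated primitives. -/

theorem IsL2loc.locallyIntegrable {m : ℕ} {u : ℝ → E m} (hu : IsL2loc u) :
    LocallyIntegrable u := by
  intro x
  exact ⟨Icc (x - 1) (x + 1), Icc_mem_nhds (by linarith) (by linarith),
    (hu (x - 1) (x + 1)).integrable one_le_two⟩

theorem _root_.Continuous.isL2loc {m : ℕ} {u : ℝ → E m} (hu : Continuous u) : IsL2loc u :=
  fun a b => by
    obtain ⟨C, hC⟩ := (isCompact_Icc (a := a) (b := b)).exists_bound_of_continuousOn hu.continuousOn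
    exact MemLp.of_bound hu.aestronglyMeasurable C
      (ae_restrict_of_forall_mem measurableSet_Icc hC)

variable {m : ℕ}

/-- The field `d1` is only an almost-everywhere representative; v is its continuous version, so
pointwise values of the velocity make sense. -/
theorem W22loc.exists_isPrimitive (u : W22loc m) :
    ∃ v, IsPrimitive u.toFun v ∧ IsPrimitive v u.d2 ∧ u.d1 =ᵐ[volume] v := by
  obtain ⟨v, hv, hvd⟩ := exists_isPrimitive_of_integral_deriv_smul u.l2_d1.locallyIntegrable
    u.l2_d2.locallyIntegrable u.weak_d2
  obtain ⟨F, hF, hFu⟩ := exists_isPrimitive_of_integral_deriv_smul u.l2_toFun.locallyIntegrable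
    u.l2_d1.locallyIntegrable u.weak_d1
  rw [u.continuous_toFun.ae_eq_iff_eq volume hF.continuous] at hFu
  exact ⟨v, hFu ▸ hF.congr_ae hvd, hv, hvd⟩

/-- A map of class `W^{2,2}_loc` given by its iterated primitives. -/
def W22loc.ofIsPrimitive (u v d : ℝ → E m) (hu : IsPrimitive u v) (hv : IsPrimitive v d)
    (hd : IsL2loc d) : W22loc m where
  toFun := u
  d1 := v
  d2 := d
  continuous_toFun := hu.continuous
  l2_toFun := hu.continuous.isL2loc
  l2_d1 := hv.continuous.isL2loc
  l2_d2 := hd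
  weak_d1 := fun _ => hu.integral_deriv_smul
  weak_d2 := fun _ => hv.integral_deriv_smul

/-! ### Splicing a map onto a constant state. -/

theorem IsL2loc.piecewise_Iio {f g : ℝ → E m} (hf : IsL2loc f) (hg : IsL2loc g) (c : ℝ) :
    IsL2loc ((Iio c).piecewise f g) := by
  intro a b
  exact MemLp.piecewise measurableSet_Iio ((hf a b).restrict _) ((hg a b).restrict _)

theorem norm_smul_add_smul_le {V : Type*} [NormedAddCommGroup V] [NormedSpace ℝ V] {α β C : ℝ}
    (hα : |α| ≤ C) (hβ : |β| ≤ C) (x y : V) : ‖α • x + β • y‖ ≤ C * (‖x‖ + ‖y‖) := by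
  refine (norm_add_le _ _).trans ?_
  rw [norm_smul, norm_smul, mul_add, Real.norm_eq_abs, Real.norm_eq_abs]
  gcongr

/-- The map `u` on `[x, ∞)` is continued to the left by the constant `p` on `(-∞, x - 1)`, with a
cubic transition on `[x - 1, x)` controlled by the data of `u` at `x`. -/
theorem exists_splice {u v d : ℝ → E m} (hu : IsPrimitive u v) (hv : IsPrimitive v d)
    (hd : IsL2loc d) (x : ℝ) (p : E m) :
    ∃ w w₁ w₂ : ℝ → E m, IsPrimitive w w₁ ∧ IsPrimitive w₁ w₂ ∧ IsL2loc w₂ ∧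
      (∀ y < x - 1, w y = p ∧ w₁ y = 0 ∧ w₂ y = 0) ∧
      (∀ y ∈ Ico (x - 1) x, ‖w y - p‖ ≤ 6 * (‖u x - p‖ + ‖v x‖) ∧
        ‖w₁ y‖ ≤ 6 * (‖u x - p‖ + ‖v x‖) ∧ ‖w₂ y‖ ≤ 6 * (‖u x - p‖ + ‖v x‖)) ∧
      ∀ y ≥ x, w y = u y ∧ w₁ y = v y ∧ w₂ y = d y := by
  classical
  set δ := u x - p with hδ
  set ν := v x with hν
  -- Hermite cubic in t = y - (x - 1): value p and slope 0 at t = 0, value u x and slope v x at t =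
  -- 1. On [0, 1] all coefficients of δ and ν in it and its first two derivatives are at most 6 in
  -- absolute value.
  set c : ℝ → E m := fun y =>
    p + ((3 * (y - (x - 1)) ^ 2 - 2 * (y - (x - 1)) ^ 3) • δ +
      ((y - (x - 1)) ^ 3 - (y - (x - 1)) ^ 2) • ν) with hc
  set c₁ : ℝ → E m := fun y =>
    (6 * (y - (x - 1)) - 6 * (y - (x - 1)) ^ 2) • δ +
      (3 * (y - (x - 1)) ^ 2 - 2 * (y - (x - 1))) • ν with hc₁
  set c₂ : ℝ → E m := fun y =>
    (6 - 12 * (y - (x - 1))) • δ + (6 * (y - (x - 1)) - 2) • ν with hc₂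
  have hid : ∀ y : ℝ, HasDerivAt (fun z : ℝ => z - (x - 1)) 1 y := fun y =>
    (hasDerivAt_id y).sub_const _
  have hcc : IsPrimitive c c₁ := by
    refine isPrimitive_of_hasDerivAt (by fun_prop) fun y => ?_
    have h1 := ((((hid y).pow 2).const_mul 3).sub (((hid y).pow 3).const_mul 2)).smul_const δ
    have h2 := (((hid y).pow 3).sub ((hid y).pow 2)).smul_const ν
    convert! (h1.add h2).const_add p using 1
    simp only [hc₁]
    congr 2 <;> norm_num <;> ring
  have hcc₁ : IsPrimitive c₁ c₂ := by
    refine isPrimitive_of_hasDerivAt (by fun_prop) fun y => ?_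
    have h1 := (((hid y).const_mul 6).sub (((hid y).pow 2).const_mul 6)).smul_const δ
    have h2 := ((((hid y).pow 2).const_mul 3).sub ((hid y).const_mul 2)).smul_const ν
    convert! h1.add h2 using 1
    simp only [hc₂]
    congr 2 <;> (norm_num; ring)
  have hzero : IsPrimitive (fun _ => p) (fun _ : ℝ => (0 : E m)) :=
    isPrimitive_of_hasDerivAt continuous_const fun y => hasDerivAt_const y p
  have hzero₁ : IsPrimitive (fun _ => (0 : E m)) (fun _ : ℝ => (0 : E m)) :=
    isPrimitive_of_hasDerivAt continuous_const fun y => hasDerivAt_const y 0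
  have hcx : c x = u x := by
    simp only [hc, sub_sub_cancel]
    norm_num [hδ]
  have hc₁x : c₁ x = v x := by
    simp only [hc₁, sub_sub_cancel]
    norm_num [hν]
  refine ⟨(Iio (x - 1)).piecewise (fun _ => p) ((Iio x).piecewise c u),
    (Iio (x - 1)).piecewise (fun _ => 0) ((Iio x).piecewise c₁ v),
    (Iio (x - 1)).piecewise (fun _ => 0) ((Iio x).piecewise c₂ d),
    hzero.glue (hcc.glue hu hcx) ?_, hzero₁.glue (hcc₁.glue hv hc₁x) ?_,
    continuous_const.isL2loc.piecewise_Iio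
      ((show Continuous c₂ by fun_prop).isL2loc.piecewise_Iio hd _) _, ?_, ?_, ?_⟩
  · simp [hc]
  · simp [hc₁]
  · intro y hy
    have : y ∈ Iio (x - 1) := hy
    simp [piecewise_eq_of_mem _ _ _ this]
  · intro y hy
    have h1 : y ∉ Iio (x - 1) := by simpa using hy.1
    have h2 : y ∈ Iio x := hy.2
    simp only [piecewise_eq_of_notMem _ _ _ h1, piecewise_eq_of_mem _ _ _ h2]
    obtain ⟨t, ht⟩ : ∃ t, t = y - (x - 1) := ⟨_, rfl⟩
    have ht0 : 0 ≤ t := by rw [ht]; linarith [hy.1]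
    have ht1 : t ≤ 1 := by rw [ht]; linarith [hy.2]
    simp only [hc, hc₁, hc₂, ← ht, add_sub_cancel_left]
    have ht2 : t ^ 2 ≤ t := by nlinarith
    have ht3 : t ^ 3 ≤ t ^ 2 := by nlinarith [sq_nonneg t]
    have ht4 : 0 ≤ t ^ 3 := by positivity
    refine ⟨norm_smul_add_smul_le ?_ ?_ _ _, norm_smul_add_smul_le ?_ ?_ _ _,
      norm_smul_add_smul_le ?_ ?_ _ _⟩ <;> rw [abs_le] <;> constructor <;> linarith
  · intro y hy
    have h1 : y ∉ Iio (x - 1) := by simp; linarith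
    have h2 : y ∉ Iio x := by simpa using hy
    simp [piecewise_eq_of_notMem _ _ _ h1, piecewise_eq_of_notMem _ _ _ h2]

/-- The energy of a spliced map is at most the energy on the transition interval plus that of the
original map to the right of it. -/
theorem lintegral_splice_le {W : E m × E m → ℝ} {u v d w w₁ w₂ : ℝ → E m} {x D : ℝ} {p : E m}
    (hp : W (p, 0) = 0)
    (hleft : ∀ y < x - 1, w y = p ∧ w₁ y = 0 ∧ w₂ y = 0)
    (hmid : ∀ y ∈ Ico (x - 1) x, ‖w₂ y‖ ^ 2 / 2 + W (w y, w₁ y) ≤ D)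
    (hright : ∀ y ≥ x, w y = u y ∧ w₁ y = v y ∧ w₂ y = d y) :
    ∫⁻ y, ENNReal.ofReal (‖w₂ y‖ ^ 2 / 2 + W (w y, w₁ y)) ≤
      ENNReal.ofReal D + ∫⁻ y in Ici x, ENNReal.ofReal (‖d y‖ ^ 2 / 2 + W (u y, v y)) := by
  rw [← lintegral_add_compl _ (measurableSet_Iio (a := x)), compl_Iio]
  refine add_le_add ?_ (le_of_eq (setLIntegral_congr_fun measurableSet_Ici fun y hy => ?_))
  · rw [← Iio_union_Ico_eq_Iio (show x - 1 ≤ x by linarith)]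
    refine (lintegral_union_le _ _ _).trans ?_
    have h0 : ∫⁻ y in Iio (x - 1), ENNReal.ofReal (‖w₂ y‖ ^ 2 / 2 + W (w y, w₁ y)) = 0 := by
      rw [setLIntegral_congr_fun (g := fun _ => 0) measurableSet_Iio fun y hy => ?_]
      · simp
      · obtain ⟨e0, e1, e2⟩ := hleft y hy
        simp [e0, e1, e2, hp]
    rw [h0, zero_add]
    refine (setLIntegral_mono measurable_const
      fun y hy => ENNReal.ofReal_le_ofReal (hmid y hy)).trans ?_
    simp
  · obtain ⟨e0, e1, e2⟩ := hright y hy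
    simp only [e0, e1, e2]

/-! ### Second-order bounds for the potential near its zeros. -/

section Taylor

variable {F : Type*} [NormedAddCommGroup F] [NormedSpace ℝ F] {W : F → ℝ}

theorem iteratedDeriv_two_line (hW : ContDiff ℝ 2 W) (z h : F) (s : ℝ) :
    iteratedDeriv 2 (fun t : ℝ => W (z + t • h)) s =
      fderiv ℝ (fderiv ℝ W) (z + s • h) h h := by
  have hl : ∀ t : ℝ, HasDerivAt (fun t : ℝ => z + t • h) h t := fun t => by
    simpa using ((hasDerivAt_id t).smul_const h).const_add z
  have h1 : deriv (fun t : ℝ => W (z + t • h)) = fun t => fderiv ℝ W (z + t • h) h :=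
    funext fun t => ((hW.differentiable (by simp) _).hasFDerivAt.comp_hasDerivAt t (hl t)).deriv
  have hW' : ContDiff ℝ 1 (fderiv ℝ W) := hW.fderiv_right (by norm_num)
  rw [iteratedDeriv_succ, iteratedDeriv_one, h1]
  exact (((hW'.differentiable (by simp) _).hasFDerivAt.comp_hasDerivAt s (hl s)).clm_apply
    (hasDerivAt_const s h)).deriv.trans (by simp)

/-- A zero of a nonnegative function is a minimum, so only the Lagrange remainder survives in the
Taylor expansion. -/
theorem exists_eq_half_second_fderiv (hW : ContDiff ℝ 2 W) (hW0 : ∀ p, 0 ≤ W p) {z : F}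
    (hz : W z = 0) (h : F) :
    ∃ θ ∈ Ioo (0 : ℝ) 1, W (z + h) = fderiv ℝ (fderiv ℝ W) (z + θ • h) h h / 2 := by
  set φ : ℝ → ℝ := fun t => W (z + t • h) with hφ
  have hφc : ContDiff ℝ 2 φ := hW.comp (contDiff_const.add (contDiff_id.smul contDiff_const))
  have hφ0 : φ 0 = 0 := by simp [hφ, hz]
  have hφ'0 : deriv φ 0 = 0 :=
    IsLocalMin.deriv_eq_zero (Eventually.of_forall fun t => by rw [hφ0]; exact hW0 _)
  obtain ⟨θ, hθ, he⟩ := taylor_mean_remainder_lagrange_iteratedDeriv (f := φ) (n := 1)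
    (zero_ne_one (α := ℝ)) (by simpa [one_add_one_eq_two] using hφc.contDiffOn)
  rw [uIoo_of_lt zero_lt_one] at hθ
  refine ⟨θ, hθ, ?_⟩
  have hdw : derivWithin φ (uIcc 0 1) 0 = 0 := by
    rw [(hφc.differentiable (by simp) 0).derivWithin
      (uniqueDiffOn_uIcc (zero_ne_one (α := ℝ)) 0 left_mem_uIcc), hφ'0]
  have ht : taylorWithinEval φ 1 (uIcc 0 1) 0 1 = 0 := by
    rw [taylorWithinEval_succ, taylor_within_zero_eval, hφ0, iteratedDerivWithin_one, hdw]
    simp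
  rw [ht] at he
  have h2 : iteratedDeriv (1 + 1) φ θ = _ := iteratedDeriv_two_line hW z h θ
  rw [h2] at he
  simpa [hφ, Nat.factorial] using he

/-- The second derivative is bounded on the compact closed R-thickening of K, which contains the
intermediate Taylor points. -/
theorem exists_le_mul_norm_sq [FiniteDimensional ℝ F] (hW : ContDiff ℝ 2 W)
    (hW0 : ∀ p, 0 ≤ W p) {K : Set F} (hK : IsCompact K) (hz : ∀ z ∈ K, W z = 0) (R : ℝ) :
    ∃ C ≥ 0, ∀ z ∈ K, ∀ h, ‖h‖ ≤ R → W (z + h) ≤ C * ‖h‖ ^ 2 := by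
  have : ProperSpace F := FiniteDimensional.proper ℝ F
  have hc : Continuous (fderiv ℝ (fderiv ℝ W)) :=
    (hW.fderiv_right (m := 1) (by norm_num)).continuous_fderiv (by simp)
  obtain ⟨C, hC⟩ := (hK.cthickening (r := R)).exists_bound_of_continuousOn
    (f := fderiv ℝ (fderiv ℝ W)) hc.continuousOn
  refine ⟨|C| / 2, by positivity, fun z hzK h hh => ?_⟩
  obtain ⟨θ, hθ, he⟩ := exists_eq_half_second_fderiv hW hW0 (hz z hzK) h
  have hmem : z + θ • h ∈ Metric.cthickening R K := by
    refine Metric.mem_cthickening_of_dist_le _ z _ _ hzK ?_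
    rw [dist_eq_norm, add_sub_cancel_left, norm_smul, Real.norm_eq_abs, abs_of_pos hθ.1]
    nlinarith [norm_nonneg h, hθ.2]
  have hle := (hC _ hmem).trans (le_abs_self C)
  have h2 := (le_abs_self _).trans
    ((fderiv ℝ (fderiv ℝ W) (z + θ • h)).le_of_opNorm₂_le_of_le hle le_rfl le_rfl (x := h) (y := h))
  rw [he]
  nlinarith

end Taylor

theorem _root_.IsCompact.exists_pos_forall_dist_lt {X : Type*} [PseudoMetricSpace X] {K : Set X}
    (hK : IsCompact K) {f : X → ℝ} (hf : Continuous f) (hpos : ∀ x ∈ K, 0 < f x) :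
    ∃ c > 0, ∃ ε > 0, ∀ k ∈ K, ∀ y, dist y k < ε → c < f y := by
  obtain ⟨c, hc, hcK⟩ := hK.exists_forall_le' hf.continuousOn hpos
  obtain ⟨ε, hε, hsub⟩ := hK.exists_thickening_subset_open (isOpen_lt continuous_const hf)
    (fun x hx => lt_of_lt_of_le (half_lt_self hc) (hcK x hx) : K ⊆ {x | c / 2 < f x})
  exact ⟨c / 2, half_pos hc, ε, hε, fun k hk y hy =>
    hsub (Metric.mem_thickening_iff.2 ⟨k, hk, hy⟩)⟩

/-- The vector from a nearest point on an oriented hypersurface is normal to it. -/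
theorem IsOrientedC2Hypersurface.exists_sub_eq_smul_normal {S : Set (E m)} {n : E m → E m}
    (hS : IsOrientedC2Hypersurface S n) {a u : E m} (ha : a ∈ S)
    (hau : Metric.infDist u S = dist u a) : ∃ α : ℝ, u - a = α • n a := by
  obtain ⟨U, f, hU, haU, hf, hSU, hgrad⟩ := hS.local_eq a ha
  obtain ⟨c, hc, hg⟩ := hgrad a ⟨ha, haU⟩
  have hfa : f a = 0 := by
    have : a ∈ {x ∈ U | f x = 0} := hSU ▸ ⟨ha, haU⟩
    exact this.2
  have hfs : HasStrictFDerivAt f (InnerProductSpace.toDual ℝ (E m) (c • n a)) a :=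
    (hf.contDiffAt (hU.mem_nhds haU)).hasStrictFDerivAt' hg.hasFDerivAt (by simp)
  have hφs : HasStrictFDerivAt (fun x => ‖x - u‖ ^ 2) (2 • innerSL ℝ (a - u)) a := by
    simpa using! (hasStrictFDerivAt_norm_sq (a - u)).comp a ((hasStrictFDerivAt_id a).sub_const u)
  have hext : IsLocalExtrOn (fun x => ‖x - u‖ ^ 2) {x | f x = f a} a := by
    refine Or.inl ?_
    filter_upwards [inter_mem_nhdsWithin _ (hU.mem_nhds haU)] with x hx
    have hxS : x ∈ S := by
      have : x ∈ S ∩ U := by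
        rw [hSU]
        exact ⟨hx.2, hx.1.trans hfa⟩
      exact this.1
    have := Metric.infDist_le_dist_of_mem (x := u) hxS
    rw [hau, dist_eq_norm, dist_eq_norm, norm_sub_rev, norm_sub_rev u x] at this
    gcongr
  -- Lagrange multipliers: `a` minimizes the squared distance to `u` on the level set of `f`. Since
  -- the gradient of `f` at `a` is nonzero, the multiplier `l` cannot vanish.
  obtain ⟨k, l, hkl, he⟩ := hext.exists_multipliers_of_hasStrictFDerivAt_1d hfs hφs
  have hv : ∀ y : E m, k * (c * inner ℝ (n a) y) + l * (2 * (inner ℝ a y - inner ℝ u y)) = 0 := fun y => by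
    have := congrArg (fun L : StrongDual ℝ (E m) => L y) he
    simpa [inner_smul_left, inner_sub_left] using this
  have hvec : (k * c) • n a + (2 * l) • (a - u) = 0 := by
    refine ext_inner_right ℝ fun y => ?_
    rw [inner_add_left, inner_smul_left, inner_smul_left, inner_zero_left, inner_sub_left]
    simp only [conj_trivial]
    linarith [hv y]
  have hl : l ≠ 0 := by
    rintro rfl
    simp only [mul_zero, zero_smul, add_zero, smul_eq_zero, mul_eq_zero] at hvec
    rcases hvec with (h | h) | h
    · exact hkl (by simp [h])
    · exact hc h
    · simpa [h] using hS.norm_normal a ha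
  refine ⟨k * c / (2 * l), ?_⟩
  have h2 : (2 * l) • (u - a) = (k * c) • n a := by
    rw [← sub_eq_zero, ← neg_eq_zero, ← hvec, smul_sub, smul_sub]
    abel
  rw [div_eq_inv_mul, mul_smul, ← h2, smul_smul, inv_mul_cancel₀ (by simpa using hl), one_smul]

/-- Near a normally nondegenerate hypersurface of zeros, the potential controls the squared
distance to it. -/
theorem exists_quadratic_lower_bound {W : E m × E m → ℝ} (hW : ContDiff ℝ 2 W)
    (hW0 : ∀ p, 0 ≤ W p) {S : Set (E m)} {n : E m → E m} (hSc : IsCompact S) (hSn : S.Nonempty)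
    (hS : IsOrientedC2Hypersurface S n) (hz : ∀ a ∈ S, W (a, 0) = 0)
    (hnd : NormallyNondegenerate W S n) :
    ∃ c > 0, ∃ ρ > 0, ∀ u v : E m, Metric.infDist u S < ρ → ‖v‖ < ρ →
      c * (Metric.infDist u S ^ 2 + ‖v‖ ^ 2) ≤ W (u, v) := by
  set Q : (E m × E m) × (E m × E m) → ℝ := fun p => fderiv ℝ (fderiv ℝ W) p.1 p.2 p.2 with hQ
  have hQc : Continuous Q := by
    have hc : Continuous (fderiv ℝ (fderiv ℝ W)) :=
      (hW.fderiv_right (m := 1) (by norm_num)).continuous_fderiv (by simp)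
    exact ((hc.comp continuous_fst).clm_apply continuous_snd).clm_apply continuous_snd
  set T : Set (ℝ × E m) := {p | p.1 ^ 2 + ‖p.2‖ ^ 2 = 1} with hT
  have hTc : IsCompact T := by
    refine ((isCompact_Icc (a := (-1 : ℝ)) (b := 1)).prod
      (isCompact_closedBall (0 : E m) 1)).of_isClosed_subset
      (isClosed_eq (by fun_prop) continuous_const) fun p hp => ?_
    have hp' : p.1 ^ 2 + ‖p.2‖ ^ 2 = 1 := hp
    refine ⟨abs_le.1 ?_, ?_⟩
    · exact abs_le_one_iff_mul_self_le_one.2 (by nlinarith [sq_nonneg ‖p.2‖])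
    · rw [mem_closedBall_zero_iff]
      nlinarith [sq_nonneg p.1, norm_nonneg p.2]
  set g : E m × (ℝ × E m) → (E m × E m) × (E m × E m) :=
    fun p => ((p.1, 0), (p.2.1 • n p.1, p.2.2)) with hg
  have hgc : ContinuousOn g (S ×ˢ T) := by
    have hn : ContinuousOn (fun p : E m × (ℝ × E m) => n p.1) (S ×ˢ T) :=
      hS.continuousOn_normal.comp continuousOn_fst fun p hp => hp.1
    have hα : ContinuousOn (fun p : E m × (ℝ × E m) => p.2.1 • n p.1) (S ×ˢ T) :=
      (by fun_prop : Continuous fun p : E m × (ℝ × E m) => p.2.1).continuousOn.smul hn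
    exact (by fun_prop : Continuous fun p : E m × (ℝ × E m) => (p.1, (0 : E m))).continuousOn.prodMk
      (hα.prodMk (by fun_prop : Continuous fun p : E m × (ℝ × E m) => p.2.2).continuousOn)
  -- Compactness of the unit normal directions gives a uniform lower bound for the Hessian that
  -- persists at nearby base points, in particular at the intermediate Taylor point.
  obtain ⟨c, hc, ε, hε, hcε⟩ := ((hSc.prod hTc).image_of_continuousOn hgc).exists_pos_forall_dist_lt
    hQc (by
      rintro _ ⟨⟨a, α, ν⟩, ⟨ha, hαν⟩, rfl⟩
      have h1 := hnd a ha α ν hαν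
      have h2 := iteratedDeriv_two_line hW (a, 0) (α • n a, ν) 0
      simp only [Prod.smul_mk, Prod.mk_add_mk, zero_add] at h2
      rw [h2] at h1
      simpa [hQ, hg] using h1)
  refine ⟨c / 2, half_pos hc, ε, hε, fun u v hu hv => ?_⟩
  obtain ⟨a, ha, hau⟩ := hSc.exists_infDist_eq_dist hSn u
  obtain ⟨α, hα⟩ := hS.exists_sub_eq_smul_normal ha hau
  have hαd : |α| = Metric.infDist u S := by
    rw [hau, dist_eq_norm, hα, norm_smul, hS.norm_normal a ha, mul_one, Real.norm_eq_abs]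
  rw [← hαd, sq_abs]
  rcases (by positivity : 0 ≤ α ^ 2 + ‖v‖ ^ 2).eq_or_lt with h0 | h0
  · rw [← h0, mul_zero]; exact hW0 _
  set r := √(α ^ 2 + ‖v‖ ^ 2) with hr
  have hr0 : 0 < r := Real.sqrt_pos.2 h0
  have hr2 : r ^ 2 = α ^ 2 + ‖v‖ ^ 2 := Real.sq_sqrt h0.le
  obtain ⟨θ, hθ, he⟩ := exists_eq_half_second_fderiv hW hW0 (hz a ha) (α • n a, v)
  have huv : ((a, 0) + (α • n a, v) : E m × E m) = (u, v) := by
    rw [← hα]; simp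
  rw [huv] at he
  -- The displacement is normalized to unit length; quadratic homogeneity of the Hessian later
  -- restores the factor r².
  have hmem : (a, (r⁻¹ * α, r⁻¹ • v)) ∈ S ×ˢ T := by
    refine ⟨ha, ?_⟩
    simp only [hT, mem_ofPred_eq, norm_smul, norm_inv, Real.norm_eq_abs, abs_of_pos hr0, mul_pow]
    rw [← mul_add, ← hr2, ← mul_pow, inv_mul_cancel₀ hr0.ne', one_pow]
  have hlt := hcε _ (mem_image_of_mem g hmem)
    ((a, 0) + θ • (α • n a, v), ((r⁻¹ * α) • n a, r⁻¹ • v)) (by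
      simp only [hg]
      rw [Prod.dist_eq, dist_self, max_eq_left dist_nonneg, dist_eq_norm, add_sub_cancel_left,
        norm_smul, Real.norm_eq_abs, abs_of_pos hθ.1]
      have : ‖(α • n a, v)‖ < ε := by
        rw [Prod.norm_mk, norm_smul, hS.norm_normal a ha, mul_one, Real.norm_eq_abs, hαd]
        exact max_lt hu hv
      nlinarith [hθ.1, hθ.2, norm_nonneg (α • n a, v)])
  have hsc : ((r⁻¹ * α) • n a, r⁻¹ • v) = r⁻¹ • (α • n a, v) := by
    rw [Prod.smul_mk, smul_smul]
  simp only [hQ, hsc, map_smul, smul_apply, smul_eq_mul] at hlt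
  rw [he, ← hr2]
  have hX : c * r ^ 2 < fderiv ℝ (fderiv ℝ W) ((a, 0) + θ • (α • n a, v)) (α • n a, v)
      (α • n a, v) := by
    have := mul_lt_mul_of_pos_right hlt (pow_pos hr0 2)
    refine this.trans_eq ?_
    field_simp
  linarith

/-- The shell ε ≤ d(·, A⁻) ≤ q is compact and lies in Ω, hence contains no zero of W(·, 0); W stays
bounded below there for small velocities too. -/
theorem exists_infDist_lt_of_potential_lt {W : E m × E m → ℝ} (hW : Continuous W)
    (hW0 : ∀ p, 0 ≤ W p) {Am Ap Ω : Set (E m)} (h1 : HypH1 W Am Ap) (h2 : HypH2 W Am Ap Ω) {q : ℝ}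
    (hq : AdmissibleRadius Am Ap Ω q) {ε : ℝ} (hε : 0 < ε) :
    ∃ η > 0, ∃ ρ > 0, ∀ u v : E m, Metric.infDist u Am ≤ q → ‖v‖ < ρ → W (u, v) < η →
      Metric.infDist u Am < ε := by
  set K : Set (E m) := {u | Metric.infDist u Am ≤ q ∧ ε ≤ Metric.infDist u Am} with hK
  have hKc : IsCompact K := by
    refine (h1.compact_m.cthickening (r := q)).of_isClosed_subset
      ((isClosed_le (Metric.continuous_infDist_pt _) continuous_const).inter
        (isClosed_le continuous_const (Metric.continuous_infDist_pt _))) fun u hu => ?_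
    obtain ⟨a, ha, hau⟩ := h1.compact_m.exists_infDist_eq_dist h1.nonempty_m u
    exact Metric.mem_cthickening_of_dist_le u a _ _ ha (hau ▸ hu.1)
  have hpos : ∀ p ∈ K ×ˢ ({0} : Set (E m)), 0 < W p := by
    rintro ⟨u, v⟩ ⟨hu, hv⟩
    obtain rfl : v = 0 := hv
    refine (hW0 _).lt_of_ne' fun h0 => ?_
    have hmem : u ∈ Am ∪ Ap := h1.zeros ▸ h0
    rcases hmem with hm | hp
    · have := hu.2
      rw [Metric.infDist_zero_of_mem hm] at this
      exact absurd this (not_le.2 hε)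
    · have : u ∈ Ap ∩ closure Ω := ⟨hp, subset_closure (hq.subset hu.1)⟩
      rw [h2.inter_closure] at this
      exact this
  obtain ⟨η, hη, ρ, hρ, hlt⟩ :=
    (hKc.prod isCompact_singleton).exists_pos_forall_dist_lt hW hpos
  refine ⟨η, hη, ρ, hρ, fun u v hu hv huv => ?_⟩
  by_contra hge
  refine lt_asymm huv (hlt (u, 0) ⟨⟨hu, not_lt.1 hge⟩, rfl⟩ (u, v) ?_)
  simpa [Prod.dist_eq] using hv

/-! ### Finite length and asymptotics at -∞. -/

theorem hasDerivAt_setIntegral_Iic {g : ℝ → ℝ} (hg : Continuous g) (hi : Integrable g) (x : ℝ) :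
    HasDerivAt (fun x => ∫ y in Iic x, g y) (g x) x := by
  have h := (isPrimitive_integral hg.locallyIntegrable 0).hasDerivAt hg x
  refine (h.const_add (∫ y in Iic 0, g y)).congr_of_eventuallyEq (Eventually.of_forall fun y => ?_)
  simp only
  rw [← intervalIntegral.integral_Iic_sub_Iic hi.integrableOn hi.integrableOn]
  abel

theorem intervalIntegral_le_setIntegral_Iic {f : ℝ → ℝ} (hf : Integrable f) (hf0 : ∀ x, 0 ≤ f x)
    {y x : ℝ} (hyx : y ≤ x) : ∫ t in y..x, f t ≤ ∫ t in Iic x, f t := by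
  rw [intervalIntegral.integral_of_le hyx]
  exact setIntegral_mono_set hf.integrableOn (Eventually.of_forall hf0)
    (LE.le.eventuallyLE Ioc_subset_Iic_self)

/-- If the speed of `u` is controlled by the derivative of a function `G` which is itself
controlled by its derivative, then `u` has finite length near `-∞`. -/
theorem exists_tendsto_atBot_of_le_deriv {V : Type*} [NormedAddCommGroup V] [NormedSpace ℝ V]
    [CompleteSpace V] {u v : ℝ → V} {G g : ℝ → ℝ} {c C x₀ : ℝ} (hc : 0 < c) (hC : 0 < C)
    (hu : ∀ x, HasDerivAt u (v x) x) (hG : ∀ x, HasDerivAt G (g x) x) (hpos : ∀ x, 0 < G x)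
    (hGg : ∀ x ≤ x₀, G x ≤ C * g x) (hvg : ∀ x ≤ x₀, c * ‖v x‖ ^ 2 ≤ g x)
    (hlim : Tendsto G atBot (𝓝 0)) : ∃ l, Tendsto u atBot (𝓝 l) := by
  -- From c|v|²G ≤ C g² one gets |v| ≤ √(C/c) g/√G, which is exactly K (√G)'.
  set K := √(4 * C / c) with hK
  have hK2 : K ^ 2 = 4 * C / c := Real.sq_sqrt (by positivity)
  have hbound : ∀ y x, y ≤ x → x ≤ x₀ → ‖u x - u y‖ ≤ K * √(G x) := by
    intro y x hyx hx
    have hB : ∀ t, HasDerivAt (fun t => K * (√(G t) - √(G y))) (K * (g t / (2 * √(G t)))) t :=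
      fun t => (((hG t).sqrt (hpos t).ne').sub_const _).const_mul K
    have := image_norm_le_of_norm_deriv_right_le_deriv_boundary (f := fun t => u t - u y)
      (f' := v) (a := y) (b := x) (B := fun t => K * (√(G t) - √(G y)))
      (B' := fun t => K * (g t / (2 * √(G t))))
      (fun t _ => ((hu t).sub_const _).continuousAt.continuousWithinAt)
      (fun t _ => ((hu t).sub_const _).hasDerivWithinAt) (by simp) hB
      (fun t ht => by
        have htx : t ≤ x₀ := ht.2.le.trans hx
        have hg0 : 0 ≤ g t := le_trans (by positivity) (hvg t htx)
        have hs : 0 < √(G t) := Real.sqrt_pos.2 (hpos t)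
        rw [← mul_div_assoc, le_div_iff₀ (by positivity)]
        refine (sq_le_sq₀ (by positivity) (by positivity)).1 ?_
        rw [mul_pow, mul_pow, mul_pow, hK2, Real.sq_sqrt (hpos t).le, div_mul_eq_mul_div,
          le_div_iff₀ hc]
        have h1 := mul_le_mul (hvg t htx) (hGg t htx) (hpos t).le hg0
        nlinarith) (right_mem_Icc.2 hyx)
    refine this.trans ?_
    gcongr
    linarith [Real.sqrt_nonneg (G y)]
  have hcau : CauchySeq fun t : ℝ => u (-t) := by
    refine Metric.cauchySeq_iff'.2 fun ε hε => ?_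
    have hl : Tendsto (fun x => K * √(G x)) atBot (𝓝 0) := by
      simpa using (hlim.sqrt).const_mul K
    obtain ⟨N, hN, hNx⟩ := ((hl.eventually (gt_mem_nhds hε)).and (eventually_le_atBot x₀)).exists
    refine ⟨-N, fun t ht => ?_⟩
    rw [neg_neg, dist_comm, dist_eq_norm]
    exact (hbound _ _ (by linarith) hNx).trans_lt hN
  obtain ⟨l, hl⟩ := cauchySeq_tendsto_of_complete hcau
  refine ⟨l, ?_⟩
  simpa [Function.comp_def] using hl.comp tendsto_neg_atBot_atTop

section Asymptotics

variable {u v d : ℝ → E m} {f : ℝ → ℝ}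

/-- Young's inequality |d| ≤ s/2 + |d|²/(2s), with `s` left free to be tuned to the length of the
interval. -/
theorem norm_sub_le_of_energy (hv : IsPrimitive v d) (hf : Integrable f)
    (hdf : ∀ x, ‖d x‖ ^ 2 / 2 ≤ f x) {s y x : ℝ} (hs : 0 < s) (hyx : y ≤ x) :
    ‖v x - v y‖ ≤ s * (x - y) / 2 + (∫ t in Iic x, f t) / s := by
  have hf0 : ∀ x, 0 ≤ f x := fun x => le_trans (by positivity) (hdf x)
  rw [hv.sub_eq y x]
  have h1 : ‖∫ t in y..x, d t‖ ≤ ∫ t in y..x, (s / 2 + f t / s) := by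
    refine intervalIntegral.norm_integral_le_of_norm_le hyx (Eventually.of_forall fun t _ => ?_)
      (intervalIntegrable_const.add ((hf.div_const s).intervalIntegrable))
    have h2 : ‖d t‖ * s ≤ s / 2 * s + f t := by nlinarith [sq_nonneg (‖d t‖ - s), hdf t]
    have h3 : s / 2 + f t / s = (s / 2 * s + f t) / s := by field_simp
    rw [h3, le_div_iff₀ hs]
    exact h2
  refine h1.trans ?_
  rw [intervalIntegral.integral_add intervalIntegrable_const
    ((hf.div_const s).intervalIntegrable), intervalIntegral.integral_const,
    intervalIntegral.integral_div, smul_eq_mul]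
  have := intervalIntegral_le_setIntegral_Iic hf hf0 hyx
  gcongr ?_ + ?_ / s
  linarith

/-- A bounded map of finite energy has vanishing derivative at `-∞`. -/
theorem tendsto_deriv_atBot_zero (hu : IsPrimitive u v) (hv : IsPrimitive v d) (hf : Integrable f)
    (hdf : ∀ x, ‖d x‖ ^ 2 / 2 ≤ f x) {M x₀ : ℝ} (hM : ∀ x ≤ x₀, ‖u x‖ ≤ M) :
    Tendsto v atBot (𝓝 0) := by
  have hM0 : 0 ≤ M := (norm_nonneg _).trans (hM x₀ le_rfl)
  rw [Metric.tendsto_nhds]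
  intro ε hε
  -- With these L and s, v varies by at most ε/2 on [x - L, x] once the energy tail is small. If |v
  -- x| ≥ ε, then `u` would move by at least Lε/2 = 4(M + 1), exceeding the 2M allowed by
  -- boundedness.
  set L := 8 * (M + 1) / ε with hL
  have hL0 : 0 < L := by positivity
  set s := ε / (2 * L) with hs
  have hs0 : 0 < s := by positivity
  filter_upwards [eventually_le_atBot x₀, (tendsto_integral_Iic_zero (f := f) (μ := volume) tendsto_id).eventually
    (gt_mem_nhds (show 0 < ε * s / 4 by positivity))] with x hx hFx
  rw [dist_zero_right]
  have hFs : (∫ t in Iic x, f t) / s < ε / 4 := by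
    rw [id] at hFx
    rw [div_lt_iff₀ hs0]; linarith
  have hkey : ∀ y ∈ uIoc (x - L) x, ‖v y - v x‖ ≤ ε / 2 := by
    intro y hy
    rw [uIoc_of_le (by linarith)] at hy
    rw [norm_sub_rev]
    refine (norm_sub_le_of_energy hv hf hdf hs0 hy.2).trans ?_
    have : s * (x - y) / 2 ≤ s * L / 2 := by gcongr; linarith [hy.1]
    have h2 : s * L / 2 = ε / 4 := by rw [hs]; field_simp; norm_num
    linarith
  have hvi : IntervalIntegrable v volume (x - L) x := hv.continuous.intervalIntegrable _ _
  have heq : ∫ y in (x - L)..x, (v y - v x) = u x - u (x - L) - L • v x := by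
    rw [intervalIntegral.integral_sub hvi intervalIntegrable_const, ← hu.sub_eq,
      intervalIntegral.integral_const, sub_sub_cancel]
  have hle := intervalIntegral.norm_integral_le_of_norm_le_const hkey
  rw [heq, sub_sub_cancel, abs_of_pos hL0] at hle
  have h3 : L * ‖v x‖ ≤ ‖u x - u (x - L) - L • v x‖ + (‖u x‖ + ‖u (x - L)‖) := by
    rw [← abs_of_pos hL0, ← Real.norm_eq_abs, ← norm_smul, Real.norm_eq_abs, abs_of_pos hL0]
    calc ‖L • v x‖ = ‖(u x - u (x - L)) - (u x - u (x - L) - L • v x)‖ := by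
          rw [sub_sub_cancel]
      _ ≤ ‖u x - u (x - L)‖ + ‖u x - u (x - L) - L • v x‖ := norm_sub_le _ _
      _ ≤ (‖u x‖ + ‖u (x - L)‖) + ‖u x - u (x - L) - L • v x‖ := by
          gcongr; exact norm_sub_le _ _
      _ = _ := add_comm _ _
  have h4 : L * ε = 8 * (M + 1) := by rw [hL]; field_simp
  have h5 := hM x hx
  have h6 := hM (x - L) (by linarith)
  by_contra hge
  rw [not_lt] at hge
  nlinarith

/-- A small tail integral forces W < η somewhere in [x - 1, x], so `u` is close to A⁻ at that point;
the small velocity carries this closeness to x. -/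
theorem tendsto_infDist_atBot_zero {W : E m × E m → ℝ} (hW : Continuous W)
    (hW0 : ∀ p, 0 ≤ W p) {Am Ap Ω : Set (E m)} (h1 : HypH1 W Am Ap) (h2 : HypH2 W Am Ap Ω) {q : ℝ}
    (hq : AdmissibleRadius Am Ap Ω q) (hu : IsPrimitive u v) (hv : Continuous v)
    (hlim : Tendsto v atBot (𝓝 0)) (hi : Integrable fun x => W (u x, v x)) {x₀ : ℝ}
    (hx₀ : ∀ x ≤ x₀, Metric.infDist (u x) Am ≤ q) :
    Tendsto (fun x => Metric.infDist (u x) Am) atBot (𝓝 0) := by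
  rw [Metric.tendsto_nhds]
  intro ε hε
  obtain ⟨η, hη, ρ, hρ, hlt⟩ :=
    exists_infDist_lt_of_potential_lt hW hW0 h1 h2 hq (half_pos hε)
  have hWc : Continuous fun x => W (u x, v x) := hW.comp (hu.continuous.prodMk hv)
  have hv' : ∀ᶠ x in atBot, ‖v x‖ < min ρ (ε / 2) := by
    simpa using (Metric.tendsto_nhds.1 hlim) (min ρ (ε / 2)) (by positivity)
  obtain ⟨x₁, hx₁⟩ := eventually_atBot.1 hv'
  filter_upwards [eventually_le_atBot x₀, eventually_le_atBot x₁,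
    (tendsto_integral_Iic_zero (f := fun x => W (u x, v x))
      (μ := volume) tendsto_id).eventually (gt_mem_nhds hη)] with x hx hxx hF
  obtain ⟨y, hy, hyη⟩ : ∃ y ∈ Icc (x - 1) x, W (u y, v y) < η := by
    by_contra! hcon
    have h3 : ∫ _ in (x - 1)..x, η ≤ ∫ y in (x - 1)..x, W (u y, v y) :=
      intervalIntegral.integral_mono_on (by linarith) intervalIntegrable_const
        (hWc.intervalIntegrable _ _) hcon
    have h4 := intervalIntegral_le_setIntegral_Iic hi (fun x => hW0 _)
      (show x - 1 ≤ x by linarith)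
    rw [intervalIntegral.integral_const, sub_sub_cancel, one_smul] at h3
    rw [id] at hF
    linarith
  have hyd := hlt (u y) (v y) (hx₀ y (hy.2.trans hx))
    ((hx₁ y (hy.2.trans hxx)).trans_le (min_le_left _ _)) hyη
  have hdist : dist (u x) (u y) ≤ ε / 2 := by
    rw [dist_eq_norm, hu.sub_eq y x]
    refine (intervalIntegral.norm_integral_le_of_norm_le_const (C := ε / 2)
      fun t ht => ?_).trans ?_
    · rw [uIoc_of_le hy.2] at ht
      exact ((hx₁ t (ht.2.trans hxx)).trans_le (min_le_right _ _)).le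
    · rw [abs_of_nonneg (by linarith [hy.2])]
      nlinarith [hy.1]
  rw [Real.dist_eq, sub_zero, abs_of_nonneg Metric.infDist_nonneg]
  have := Metric.infDist_le_infDist_add_dist (s := Am) (x := u x) (y := u y)
  linarith

end Asymptotics

/-! ### Competitors and the comparison argument. -/

variable {W : E m × E m → ℝ} {Am Ap : Set (E m)} {q : ℝ}

theorem exists_competitor_energy_le {u v d : ℝ → E m} (hu : IsPrimitive u v)
    (hv : IsPrimitive v d) (hd : IsL2loc d) {p : E m} (hp : p ∈ Am) (hWp : W (p, 0) = 0)
    (hq : 0 ≤ q) (hAp : ∃ xp, ∀ x ≥ xp, Metric.infDist (u x) Ap ≤ q) (x : ℝ) {D : ℝ}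
    (hD : ∀ a b e : E m, ‖a‖ ≤ 6 * (‖u x - p‖ + ‖v x‖) → ‖b‖ ≤ 6 * (‖u x - p‖ + ‖v x‖) →
      ‖e‖ ≤ 6 * (‖u x - p‖ + ‖v x‖) → ‖e‖ ^ 2 / 2 + W (p + a, b) ≤ D) :
    ∃ w ∈ competitors Am Ap q, energy W w ≤
      ENNReal.ofReal D + ∫⁻ y in Ici x, ENNReal.ofReal (‖d y‖ ^ 2 / 2 + W (u y, v y)) := by
  obtain ⟨w, w₁, w₂, hw, hw₁, hw₂, hleft, hmid, hright⟩ := exists_splice hu hv hd x p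
  obtain ⟨xp, hxp⟩ := hAp
  -- The splice is known to equal p only strictly left of x - 1, so x - 2 leaves room.
  refine ⟨.ofIsPrimitive w w₁ w₂ hw hw₁ hw₂, ⟨x - 2, max x xp, ?_, fun y hy => ?_, fun y hy => ?_⟩,
    lintegral_splice_le hWp hleft (fun y hy => ?_) hright⟩
  · exact lt_of_lt_of_le (by linarith) (le_max_left _ _)
  · change Metric.infDist (w y) Am ≤ q
    rw [(hleft y (by linarith)).1, Metric.infDist_zero_of_mem hp]
    exact hq
  · change Metric.infDist (w y) Ap ≤ q
    rw [(hright y ((le_max_left _ _).trans hy)).1]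
    exact hxp y ((le_max_right _ _).trans hy)
  · obtain ⟨e0, e1, e2⟩ := hmid y hy
    have := hD (w y - p) (w₁ y) (w₂ y) e0 e1 e2
    rwa [add_sub_cancel] at this

/-- Splicing a constant in A⁺ onto a constant in A⁻ costs energy only on a unit interval. By
minimality the minimizer then has finite energy. -/
theorem exists_competitor_energy_lt_top (hW : Continuous W) (h1 : HypH1 W Am Ap) (hq : 0 ≤ q) :
    ∃ w ∈ competitors Am Ap q, energy W w < ⊤ := by
  obtain ⟨p, hp⟩ := h1.nonempty_m
  obtain ⟨p', hp'⟩ := h1.nonempty_p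
  have hzero : ∀ a ∈ Am ∪ Ap, W (a, 0) = 0 := fun a ha => by
    rw [← h1.zeros] at ha; exact ha
  have hc : ∀ a : E m, IsPrimitive (fun _ => a) (fun _ : ℝ => (0 : E m)) := fun a =>
    isPrimitive_of_hasDerivAt continuous_const fun y => hasDerivAt_const y a
  set R := 6 * (‖p' - p‖ + ‖(0 : E m)‖)
  obtain ⟨D, hD⟩ := (((isCompact_closedBall (0 : E m) R).prod
    ((isCompact_closedBall (0 : E m) R).prod (isCompact_closedBall (0 : E m) R))).bddAbove_image
    (f := fun t : E m × E m × E m => ‖t.2.2‖ ^ 2 / 2 + W (p + t.1, t.2.1))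
    (by fun_prop : Continuous _).continuousOn)
  obtain ⟨w, hw, hle⟩ := exists_competitor_energy_le (W := W) (Am := Am) (Ap := Ap) (q := q)
    (hc p') (hc 0) continuous_const.isL2loc hp (hzero p (.inl hp)) hq
    ⟨0, fun x _ => by rw [Metric.infDist_zero_of_mem hp']; exact hq⟩ 0 (D := D)
    fun a b e ha hb he => hD ⟨(a, b, e), ⟨mem_closedBall_zero_iff.2 ha,
      mem_closedBall_zero_iff.2 hb, mem_closedBall_zero_iff.2 he⟩, rfl⟩
  refine ⟨w, hw, hle.trans_lt ?_⟩
  simp [hzero p' (.inr hp')]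

end Heteroclinic

open Heteroclinic in
theorem corollary3p2 (m : ℕ)
    (W : Heteroclinic.E m × Heteroclinic.E m → ℝ)
    (hW : ContDiff ℝ 2 W) (hW0 : ∀ p, 0 ≤ W p)
    (Am Ap Ω : Set (Heteroclinic.E m))
    (h1 : Heteroclinic.HypH1 W Am Ap)
    (h2 : Heteroclinic.HypH2 W Am Ap Ω)
    (h3 : Heteroclinic.HypH3 W)
    (q : ℝ) (hq : Heteroclinic.AdmissibleRadius Am Ap Ω q)
    (n : Heteroclinic.E m → Heteroclinic.E m)
    (hS : Heteroclinic.IsOrientedC2Hypersurface Am n)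
    (hnd : Heteroclinic.NormallyNondegenerate W Am n)
    (ubar : Heteroclinic.W22loc m)
    (hmem : ubar ∈ Heteroclinic.competitors Am Ap q)
    (hmin : IsMinOn (Heteroclinic.energy W) (Heteroclinic.competitors Am Ap q) ubar) :
    ∃ l ∈ Am, Tendsto ubar.toFun atBot (𝓝 l) := by
  have hWc := hW.continuous
  have hzero : ∀ a ∈ Am, W (a, 0) = 0 := fun a ha => by
    have : a ∈ Am ∪ Ap := .inl ha
    rw [← h1.zeros] at this
    exact this
  obtain ⟨v, hu, hv, hd1⟩ := ubar.exists_isPrimitive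
  set u := ubar.toFun
  set d := ubar.d2
  set f : ℝ → ℝ := fun x => ‖d x‖ ^ 2 / 2 + W (u x, v x) with hf
  have hen : energy W ubar = ∫⁻ x, ENNReal.ofReal (f x) :=
    lintegral_congr_ae (hd1.mono fun x hx => by
      simp only [hf]
      rw [hx])
  have hfin : energy W ubar < ⊤ := by
    obtain ⟨w, hw, hlt⟩ := exists_competitor_energy_lt_top hWc h1 hq.pos.le
    exact (hmin hw).trans_lt hlt
  have hf0 : ∀ x, 0 ≤ f x := fun x => add_nonneg (by positivity) (hW0 _)
  have hg : Continuous fun x => W (u x, v x) := hWc.comp (hu.continuous.prodMk hv.continuous)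
  have hfm : AEStronglyMeasurable f :=
    ((hv.locallyIntegrable.aestronglyMeasurable.norm.pow 2).mul_const 2⁻¹).add
      hg.aestronglyMeasurable
  have hfi : Integrable f := by
    refine ⟨hfm, ?_⟩
    rw [hasFiniteIntegral_iff_ofReal (Eventually.of_forall hf0), ← hen]
    exact hfin
  have hgi : Integrable fun x => W (u x, v x) :=
    hfi.mono' hg.aestronglyMeasurable (Eventually.of_forall fun x => by
      rw [Real.norm_of_nonneg (hW0 _)]
      exact le_add_of_nonneg_left (by positivity))
  obtain ⟨xm, xp, -, hxm, hxp⟩ := hmem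
  obtain ⟨M, hM⟩ := (h1.compact_m.isBounded.cthickening (δ := q)).exists_norm_le
  have hubd : ∀ x ≤ xm, ‖u x‖ ≤ M := fun x hx => by
    obtain ⟨a, ha, hau⟩ := h1.compact_m.exists_infDist_eq_dist h1.nonempty_m (u x)
    exact hM _ (Metric.mem_cthickening_of_dist_le _ a _ _ ha (hau ▸ hxm x hx))
  have hvlim : Tendsto v atBot (𝓝 0) := tendsto_deriv_atBot_zero hu hv hfi
    (fun x => le_add_of_nonneg_right (hW0 _)) hubd
  have hulim : Tendsto (fun x => Metric.infDist (u x) Am) atBot (𝓝 0) :=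
    tendsto_infDist_atBot_zero hWc hW0 h1 h2 hq hu hv.continuous hvlim hgi hxm
  obtain ⟨c, hc, ρ, hρ, hlow⟩ :=
    exists_quadratic_lower_bound hW hW0 h1.compact_m h1.nonempty_m hS hzero hnd
  -- The radius 12 suffices because the transition stays within 6(|u x - p| + |v x|), and both terms
  -- are below 1 near -∞.
  obtain ⟨C, hC0, hC⟩ := exists_le_mul_norm_sq hW hW0 (h1.compact_m.prod isCompact_singleton)
    (fun z hz => by
      obtain ⟨a, b⟩ := z
      obtain ⟨ha, rfl⟩ : a ∈ Am ∧ b = 0 := hz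
      exact hzero a ha : ∀ z ∈ Am ×ˢ ({0} : Set (E m)), W z = 0) 12
  have hsmall : ∀ᶠ x in atBot, Metric.infDist (u x) Am < min ρ 1 ∧ ‖v x‖ < min ρ 1 :=
    (hulim.eventually (gt_mem_nhds (by positivity))).and
      (by simpa using (Metric.tendsto_nhds.1 hvlim) (min ρ 1) (by positivity))
  obtain ⟨x₀, hx₀⟩ := eventually_atBot.1 hsmall
  -- The transition costs at most (6s)²/2 + C(6s)², where s = |u x - p| + |v x|; the factor 2 comes
  -- from s² ≤ 2(|u x - p|² + |v x|²).
  set B := 2 * (18 + 36 * C) with hB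
  have hB0 : 0 < B := by positivity
  have hcontrol : ∀ x ≤ x₀, ∫ y in Iic x, W (u y, v y) ≤ B / c * W (u x, v x) := by
    intro x hx
    obtain ⟨hux, hvx⟩ := hx₀ x hx
    obtain ⟨p, hp, hpu⟩ := h1.compact_m.exists_infDist_eq_dist h1.nonempty_m (u x)
    have hlow' := hlow (u x) (v x) (hux.trans_le (min_le_left _ _)) (hvx.trans_le (min_le_left _ _))
    have hux1 := hux.trans_le (min_le_right _ _)
    have hvx1 := hvx.trans_le (min_le_right _ _)
    rw [hpu, dist_eq_norm] at hlow' hux1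
    set s := ‖u x - p‖ + ‖v x‖ with hs
    have hs0 : 0 ≤ s := by positivity
    obtain ⟨w, hw, hle⟩ := exists_competitor_energy_le (W := W) (Am := Am) (Ap := Ap) (q := q)
      hu hv ubar.l2_d2 hp (hzero p hp) hq.pos.le ⟨xp, hxp⟩ x (D := (18 + 36 * C) * s ^ 2)
      (fun a b e ha hb he => by
        have hab : ‖(a, b)‖ ≤ 6 * s := by rw [Prod.norm_mk]; exact max_le ha hb
        have h4 := hC (p, 0) ⟨hp, rfl⟩ (a, b) (hab.trans (by linarith))
        rw [Prod.mk_add_mk, zero_add] at h4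
        have h5 : ‖(a, b)‖ ^ 2 ≤ (6 * s) ^ 2 := by gcongr
        have h6 : ‖e‖ ^ 2 ≤ (6 * s) ^ 2 := by gcongr
        have h7 : C * ‖(a, b)‖ ^ 2 ≤ C * (6 * s) ^ 2 := by gcongr
        linarith)
    -- The minimizer and the competitor share the energy on [x, ∞), which is finite and can be
    -- cancelled.
    have hcmp : ∫⁻ y in Iio x, ENNReal.ofReal (f y) ≤
        ENNReal.ofReal ((18 + 36 * C) * s ^ 2) := by
      have h4 : energy W ubar ≤ _ := (hmin hw).trans hle
      rw [hen, ← lintegral_add_compl _ (measurableSet_Iio (a := x)), compl_Iio] at h4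
      refine (ENNReal.add_le_add_iff_right (ne_top_of_le_ne_top (hen ▸ hfin.ne) ?_)).1 h4
      exact setLIntegral_le_lintegral _ _
    have hreal : ∫ y in Iic x, f y ≤ (18 + 36 * C) * s ^ 2 := by
      rw [integral_Iic_eq_integral_Iio, integral_eq_lintegral_of_nonneg_ae
        (Eventually.of_forall hf0) hfm.restrict]
      exact ENNReal.toReal_le_of_le_ofReal (by positivity) hcmp
    have hgf : ∫ y in Iic x, W (u y, v y) ≤ ∫ y in Iic x, f y :=
      integral_mono hgi.integrableOn hfi.integrableOn fun y =>
        le_add_of_nonneg_left (by positivity)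
    have hs2 : s ^ 2 ≤ 2 * (‖u x - p‖ ^ 2 + ‖v x‖ ^ 2) := by
      rw [hs]; nlinarith [sq_nonneg (‖u x - p‖ - ‖v x‖)]
    rw [div_mul_eq_mul_div, le_div_iff₀ hc]
    have h8 : (18 + 36 * C) * s ^ 2 ≤ B * (‖u x - p‖ ^ 2 + ‖v x‖ ^ 2) := by
      rw [hB]
      nlinarith
    calc (∫ y in Iic x, W (u y, v y)) * c ≤ B * (‖u x - p‖ ^ 2 + ‖v x‖ ^ 2) * c := by
          gcongr; linarith
      _ = B * (c * (‖u x - p‖ ^ 2 + ‖v x‖ ^ 2)) := by ring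
      _ ≤ B * W (u x, v x) := by gcongr
  have hK : 0 < B / c := by positivity
  -- adding an exponential keeps the primitive of the potential positive
  obtain ⟨l, hl⟩ := exists_tendsto_atBot_of_le_deriv (u := u) (v := v)
    (G := fun x => (∫ y in Iic x, W (u y, v y)) + Real.exp (x / (B / c)))
    (g := fun x => W (u x, v x) + Real.exp (x / (B / c)) * (1 / (B / c))) (x₀ := x₀) hc hK
    (hu.hasDerivAt hv.continuous)
    (fun x => (hasDerivAt_setIntegral_Iic hg hgi x).add
      ((hasDerivAt_id x).div_const (B / c)).exp)
    (fun x => add_pos_of_nonneg_of_pos (setIntegral_nonneg measurableSet_Iic fun y _ => hW0 _)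
      (Real.exp_pos _))
    (fun x hx => by
      have h4 := hcontrol x hx
      have h5 : B / c * (Real.exp (x / (B / c)) * (1 / (B / c))) = Real.exp (x / (B / c)) := by
        field_simp
      rw [mul_add, h5]
      linarith)
    (fun x hx => by
      obtain ⟨hux, hvx⟩ := hx₀ x hx
      have h4 := hlow (u x) (v x) (hux.trans_le (min_le_left _ _))
        (hvx.trans_le (min_le_left _ _))
      have h5 : 0 ≤ Real.exp (x / (B / c)) * (1 / (B / c)) := by positivity
      have h6 : 0 ≤ c * Metric.infDist (u x) Am ^ 2 := by positivity
      linarith)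
    (by
      have h4 : Tendsto (fun x => ∫ y in Iic x, W (u y, v y)) atBot (𝓝 0) :=
        tendsto_integral_Iic_zero tendsto_id
      have h5 : Tendsto (fun x => Real.exp (x / (B / c))) atBot (𝓝 0) :=
        Real.tendsto_exp_atBot.comp (tendsto_id.atBot_div_const hK)
      simpa using h4.add h5)
  refine ⟨l, ?_, hl⟩
  rw [h1.compact_m.isClosed.mem_iff_infDist_zero h1.nonempty_m]
  exact tendsto_nhds_unique
    (((Metric.continuous_infDist_pt Am).tendsto l).comp hl) hulim
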